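/- Let $b\ge 2$, $d\ge 1$ and $t\ge 0$ be integers. For $k=(k_1,\dots,k_d)$ and $c=(c_1,\dots,c_d)$ with integers $k_j\ge 0$ and $0\le c_j<b^{k_j}$, let $E(k,c)=\prod_{j=1}^d[c_jb^{-k_j},(c_j+1)b^{-k_j})$ and $|k|=\sum_j k_j$. For $m\ge t$, points $z_1,\dots,z_{b^m}\in[0,1)^d$ form a $(t,m,d)$-net in base $b$ if every $E(k,c)$ with $|k|\le m-t$ contains exactly $b^{m-|k|}$ of them (with multiplicity). Points $a_1,a_2,\dots\in[0,1)^d$ form a $(t,d)$-sequence in base $b$ if for all integers $m\ge t$ and $r\ge 1$ the block $a_{(r-1)b^m+1},\dots,a_{rb^m}$ is a $(t,m,d)$-net in base $b$. The gain coefficients of points $z_1,\dots,z_n\in[0,1)^d$ in base $b$ are, for nonempty $u\subseteq\{1,\dots,d\}$ and integers $k_j\ge 0$ $(j\in u)$, $$\Gamma_{u,k}=\frac1{n(b-1)^{|u|}}\sum_{i=1}^n\sum_{i'=1}^n\prod_{j\in u}\Bigl(b\,\mathbf 1\{\lfloor b^{k_j+1}z_{ij}\rfloor=\lfloor b^{k_j+1}z_{i'j}\rfloor\}-\mathbf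 1\{\lfloor b^{k_j}z_{ij}\rfloor=\lfloor b^{k_j}z_{i'j}\rfloor\}\Bigr).$$ A nested uniform scramble uses permutations $\pi_{j,s}$ of $\{0,\dots,b-1\}$, one for each coordinate $j$ and each finite (possibly empty) string $s$ of base $b$ digits, which are independent and uniformly distributed over all $b!$ permutations. It maps $a\in[0,1)^d$ with coordinates $a_{j}=\sum_{l\ge1}a_{j,l}b^{-l}$ (the digit expansion with $a_{j,l}=\lfloor b^la_j\rfloor \bmod b$) to the point $x$ with coordinates $x_j=\sum_{l\ge1}\pi_{j,(a_{j,1},\dots,a_{j,l-1})}(a_{j,l})\,b^{-l}$. Theorem. Let $a_1,a_2,\dots$ be a $(t,d)$-sequence in base $b$ such that, for some $\Gamma<\infty$, all gain coefficients of all its blocks $a_{(r-1)b^m+1},\dots,a_{rb^m}$ ($m\ge t$, $r\ge1$) are at most $\Gamma$. Let $x_1,x_2,\dots$ be obtained by applying one and the same nested uniform scramble to all of $a_1,a_2,\dots$. Let $f\in L^2[0,1]^d$ be real-valued with $\int_{[0,1]^d}f(x)\,\mathrm dx=\mu$, and let $\hat\mu_n=\frac1n\sum_{i=1}^nf(x_i)$.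 Then $$\Pr\Bigl(\lim_{n\to\infty}\hat\mu_n=\mu\Bigr)=1,$$ where $n$ runs through all positive integers. -/

import Mathlib

open MeasureTheory ProbabilityTheory Filter Topology

namespace ScrambledNet

/-- The elementary interval `E(k, c) = ∏ⱼ [cⱼ / b ^ kⱼ, (cⱼ + 1) / b ^ kⱼ)` in base `b`. -/
def elementaryInterval (b : ℕ) {d : ℕ} (k c : Fin d → ℕ) : Set (Fin d → ℝ) :=
  Set.univ.pi fun j => Set.Ico ((c j : ℝ) / (b : ℝ) ^ k j) (((c j : ℝ) + 1) / (b : ℝ) ^ k j)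

/-- The `b ^ m` points `x` of `[0,1)^d` form a `(t, m, d)`-net in base `b` (where `t ≤ m`):
every elementary interval `E(k, c)` with `|k| ≤ m - t` contains exactly `b ^ (m - |k|)` of them,
counted with multiplicity. -/
def IsNet (b t m d : ℕ) (x : Fin (b ^ m) → Fin d → ℝ) : Prop :=
  (∀ i j, x i j ∈ Set.Ico (0 : ℝ) 1) ∧
  ∀ k c : Fin d → ℕ, (∀ j, c j < b ^ k j) → (∑ j, k j) + t ≤ m →
    Set.ncard {i | x i ∈ elementaryInterval b k c} = b ^ (m - ∑ j, k j)

/-- The `r`-th block (`r = 0, 1, 2, …`) of `b ^ m` consecutive points of a sequence `a`.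
Sequences are indexed from `0` here, so that this block consists of
`a (r * b ^ m), …, a ((r + 1) * b ^ m - 1)`. -/
def block (b m r : ℕ) {d : ℕ} (a : ℕ → Fin d → ℝ) : Fin (b ^ m) → Fin d → ℝ :=
  fun i => a (r * b ^ m + i)

/-- `a` is a `(t, d)`-sequence in base `b`: its points lie in `[0,1)^d`, and for all `m ≥ t` each
of its blocks of `b ^ m` points is a `(t, m, d)`-net in base `b`. -/
def IsSequence (b t d : ℕ) (a : ℕ → Fin d → ℝ) : Prop :=
  (∀ i j, a i j ∈ Set.Ico (0 : ℝ) 1) ∧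
  ∀ m, t ≤ m → ∀ r, IsNet b t m d (block b m r a)

/-- The gain coefficient `Γ_{u,k}` of the points `x 0, …, x (n - 1)` in base `b`, for a set `u` of
coordinates and a vector `k` of resolutions (only the `k j` with `j ∈ u` matter):
`1 / (n (b - 1) ^ |u|) * ∑ᵢ ∑ᵢ' ∏_{j ∈ u} (b 1{⌊b ^ (kⱼ + 1) x_{ij}⌋ = ⌊b ^ (kⱼ + 1) x_{i'j}⌋}
  - 1{⌊b ^ kⱼ x_{ij}⌋ = ⌊b ^ kⱼ x_{i'j}⌋})`. -/
noncomputable def gainCoefficient (b : ℕ) {n d : ℕ} (x : Fin n → Fin d → ℝ)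
    (u : Finset (Fin d)) (k : Fin d → ℕ) : ℝ :=
  1 / ((n : ℝ) * ((b : ℝ) - 1) ^ u.card) *
    ∑ i, ∑ i', ∏ j ∈ u,
      ((b : ℝ) * (if ⌊(b : ℝ) ^ (k j + 1) * x i j⌋ = ⌊(b : ℝ) ^ (k j + 1) * x i' j⌋
          then 1 else 0)
        - (if ⌊(b : ℝ) ^ k j * x i j⌋ = ⌊(b : ℝ) ^ k j * x i' j⌋ then 1 else 0))

/-- All gain coefficients (for nonempty `u`) of the nets that make up the `(t, d)`-sequence `a`
are at most `Γ`. -/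
def GainCoefficientsLE (b t d : ℕ) (a : ℕ → Fin d → ℝ) (Γ : ℝ) : Prop :=
  ∀ m, t ≤ m → ∀ r, ∀ u : Finset (Fin d), u.Nonempty → ∀ k : Fin d → ℕ,
    gainCoefficient b (block b m r a) u k ≤ Γ

/-- The random permutations of a nested uniform scramble: to each coordinate `j` and each finite
string of base `b` digits belongs a permutation of the digits, and these permutations are
independent and uniformly distributed over all `b !` permutations. -/
structure IsUniformPermutations {Ω : Type*} [MeasurableSpace Ω] (P : Measure Ω) (b d : ℕ)
    (π : Fin d × List (Fin b) → Ω → Equiv.Perm (Fin b)) : Prop where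
  measurable : ∀ v, Measurable[_, ⊤] (π v)
  uniform : ∀ v (σ : Equiv.Perm (Fin b)), P {ω | π v ω = σ} = ((b.factorial : ℕ) : ENNReal)⁻¹
  indep : iIndepFun (m := fun _ => ⊤) π P

/-- The image of a point `a` of `[0,1)^d` under the nested scramble with permutations `π`: the
`l`-th digit of the `j`-th coordinate is permuted by the permutation that belongs to `j` and to the
string of the preceding digits of that coordinate. -/
noncomputable def scramble {b d : ℕ} [NeZero b]
    (π : Fin d × List (Fin b) → Equiv.Perm (Fin b)) (a : Fin d → ℝ) : Fin d → ℝ :=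
  fun j => Real.ofDigits fun l =>
    π (j, (List.range l).map (Real.digits (a j) b)) (Real.digits (a j) b l)

end ScrambledNet

open scoped ComplexConjugate ENNReal

namespace ScrambledNet

variable {Ω : Type*} [MeasurableSpace Ω] {P : Measure Ω} {b d K : ℕ}

/-! The proof combines an `O(n)` bound on the variance of block sums with a chaining argument over
scales. Variance: functions of the first `K` digits are expanded in characters of the group `Fin d →
Fin K → Fin b`. Left translation of the permutations preserves their law and shifts all scrambled
digits, so distinct characters are uncorrelated even at different points
(`integral_char_mul_conj_char`). The second moment of the sum of one nontrivial character over `n`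
points is `n` times a gain coefficient (`exists_integral_sum_char_mul_conj`), and Parseval bounds
the variance by `n Γ ‖f‖²`. Letting `K → ∞` covers bounded continuous functions, and density covers
`L²`. Blocks shorter than `b ^ t` cost only a constant, so every block sum has second moment at most
`C b ^ m` (`exists_integral_sq_sum_block_le`). Chaining: the base `b` expansion of `n < b ^ K`
splits the first `n` terms into fewer than `b` blocks on each of `K` scales. By Cauchy–Schwarz the
squared partial sum is at most `K b Q`, with `Q` the sum of all squared block sums within the first
`b ^ K` terms. As `E Q ≤ C K b ^ K`, the expectations of `K Q / b ^ (2 K)` are summable; these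
quantities therefore tend to zero almost surely, and they control the averages for every `n`, not
just along a subsequence. -/

instance permMeasurableSpace : MeasurableSpace (Equiv.Perm (Fin b)) := ⊤

instance permDiscreteMeasurableSpace : DiscreteMeasurableSpace (Equiv.Perm (Fin b)) :=
  ⟨fun _ => MeasurableSpace.measurableSet_top⟩

/-! ### Invariance of the law of the permutations -/

namespace IsUniformPermutations

variable {π π' : Fin d × List (Fin b) → Ω → Equiv.Perm (Fin b)}

lemma measurable_apply (hπ : IsUniformPermutations P b d π) (v) : Measurable (π v) :=
  hπ.measurable v

lemma measurable_pi (hπ : IsUniformPermutations P b d π) : Measurable fun ω v => π v ω :=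
  measurable_pi_lambda _ hπ.measurable_apply

lemma map_apply_singleton (hπ : IsUniformPermutations P b d π) (v) (σ : Equiv.Perm (Fin b)) :
    P.map (π v) {σ} = ((b.factorial : ℕ) : ENNReal)⁻¹ := by
  rw [Measure.map_apply (hπ.measurable_apply v) (measurableSet_singleton σ)]
  exact hπ.uniform v σ

/-- Independence and uniform marginals determine the joint law as a product measure. Combined with
`mul_left` this gives the translation invariance behind the orthogonality relations below. -/
lemma map_eq_map [IsProbabilityMeasure P] (hπ : IsUniformPermutations P b d π)
    (hπ' : IsUniformPermutations P b d π') :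
    P.map (fun ω v => π v ω) = P.map (fun ω v => π' v ω) := by
  rw [hπ.indep.map_fun_eq_infinitePi_map hπ.measurable_apply,
    hπ'.indep.map_fun_eq_infinitePi_map hπ'.measurable_apply]
  congr 1
  ext v : 1
  refine Measure.ext_iff_singleton.2 fun σ => ?_
  rw [hπ.map_apply_singleton, hπ'.map_apply_singleton]

lemma mul_left (hπ : IsUniformPermutations P b d π)
    (σ : Fin d × List (Fin b) → Equiv.Perm (Fin b)) :
    IsUniformPermutations P b d (fun v ω => σ v * π v ω) where
  measurable v := (Measurable.of_discrete (f := fun τ => σ v * τ)).comp (hπ.measurable_apply v)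
  uniform v τ := by
    rw [← hπ.uniform v ((σ v)⁻¹ * τ)]
    congr 1
    ext ω
    simp [eq_inv_mul_iff_mul_eq]
  indep := hπ.indep.comp (fun v τ => σ v * τ) fun v => Measurable.of_discrete

/-- The law of the random permutations is invariant under left multiplication. -/
lemma integral_mul_left [IsProbabilityMeasure P] (hπ : IsUniformPermutations P b d π)
    (σ : Fin d × List (Fin b) → Equiv.Perm (Fin b))
    {F : (Fin d × List (Fin b) → Equiv.Perm (Fin b)) → ℂ} (hF : Measurable F) :
    ∫ ω, F (fun v => σ v * π v ω) ∂P = ∫ ω, F (fun v => π v ω) ∂P := by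
  have h := (hπ.mul_left σ).map_eq_map hπ
  rw [← integral_map (φ := fun ω v => σ v * π v ω) (hπ.mul_left σ).measurable_pi.aemeasurable
    hF.aestronglyMeasurable, h,
    integral_map hπ.measurable_pi.aemeasurable hF.aestronglyMeasurable]

lemma integral_apply [IsProbabilityMeasure P] (hπ : IsUniformPermutations P b d π)
    (v) (F : Equiv.Perm (Fin b) → ℂ) :
    ∫ ω, F (π v ω) ∂P = (b.factorial : ℂ)⁻¹ * ∑ σ, F σ := by
  have := Measure.isProbabilityMeasure_map (hπ.measurable_apply v).aemeasurable (μ := P)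
  rw [← integral_map (hπ.measurable_apply v).aemeasurable
    (Measurable.of_discrete (f := F)).aestronglyMeasurable,
    integral_fintype Integrable.of_finite, Finset.mul_sum]
  refine Finset.sum_congr rfl fun σ _ => ?_
  rw [Measure.real, hπ.map_apply_singleton, Complex.real_smul]
  simp

end IsUniformPermutations

/-! ### Scrambled digits: uniformity and uncorrelated characters -/

section Digits

variable [NeZero b]

/-- The index of the permutation that scrambles digit `l` of coordinate `j` of the point `a`. -/
noncomputable def node (b : ℕ) [NeZero b] (a : Fin d → ℝ) (j : Fin d) (l : ℕ) :
    Fin d × List (Fin b) :=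
  (j, (List.range l).map (Real.digits (a j) b))

/-- The first `K` digits of the coordinates of the scrambled point. -/
noncomputable def scrambledDigits (K : ℕ) (π : Fin d × List (Fin b) → Equiv.Perm (Fin b))
    (a : Fin d → ℝ) : Fin d → Fin K → Fin b :=
  fun j l => π (node b a j l) (Real.digits (a j) b l)

lemma node_eq_node_iff {a a' : Fin d → ℝ} {j j' : Fin d} {l l' : ℕ} :
    node b a j l = node b a' j' l' ↔
      j = j' ∧ l = l' ∧ ∀ i < l, Real.digits (a j) b i = Real.digits (a' j') b i := by
  simp only [node, Prod.mk.injEq]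
  refine and_congr_right fun _ => ⟨fun h => ?_, ?_⟩
  · have hl : l = l' := by simpa using congrArg List.length h
    subst hl
    exact ⟨rfl, by simpa using h⟩
  · rintro ⟨rfl, h⟩
    simpa using h

lemma measurable_scrambledDigits (a : Fin d → ℝ) :
    Measurable fun π => scrambledDigits (b := b) K π a :=
  measurable_pi_lambda _ fun j => measurable_pi_lambda _ fun l =>
    (Measurable.of_discrete (f := fun σ : Equiv.Perm (Fin b) => σ (Real.digits (a j) b l))).comp
      (measurable_pi_apply (node b a j l))

/-- The permutations that shift the first `K` digits of every coordinate by `h`. -/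
def digitalShift (h : Fin d → Fin K → Fin b) (v : Fin d × List (Fin b)) : Equiv.Perm (Fin b) :=
  if hv : v.2.length < K then Equiv.addLeft (h v.1 ⟨v.2.length, hv⟩) else 1

/-- The node is chosen by the digits of the unscrambled point, so multiplying permutations on the
left changes each output digit without affecting which permutations are used later. -/
lemma scrambledDigits_digitalShift_mul (h : Fin d → Fin K → Fin b)
    (π : Fin d × List (Fin b) → Equiv.Perm (Fin b)) (a : Fin d → ℝ) :
    scrambledDigits K (fun v => digitalShift h v * π v) a = h + scrambledDigits K π a := by
  ext j l : 2
  simp [scrambledDigits, digitalShift, node]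

variable {π : Fin d × List (Fin b) → Ω → Equiv.Perm (Fin b)}

lemma measurable_scrambledDigits_comp (hπ : IsUniformPermutations P b d π) (a : Fin d → ℝ) :
    Measurable fun ω => scrambledDigits K (fun v => π v ω) a :=
  (measurable_scrambledDigits a).comp hπ.measurable_pi

variable [IsProbabilityMeasure P]

/-- The first `K` digits of a scrambled point are uniformly distributed. -/
lemma integral_scrambledDigits (hπ : IsUniformPermutations P b d π) (a : Fin d → ℝ)
    (φ : (Fin d → Fin K → Fin b) → ℂ) :
    ∫ ω, φ (scrambledDigits K (fun v => π v ω) a) ∂P =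
      (Fintype.card (Fin d → Fin K → Fin b) : ℂ)⁻¹ * ∑ y, φ y := by
  rw [eq_inv_mul_iff_mul_eq₀ (by exact_mod_cast Fintype.card_ne_zero)]
  have hmeas : Measurable fun π => φ (scrambledDigits K π a) :=
    (measurable_of_countable φ).comp (measurable_scrambledDigits a)
  have key (h : Fin d → Fin K → Fin b) : ∫ ω, φ (scrambledDigits K (fun v => π v ω) a) ∂P =
      ∫ ω, φ (h + scrambledDigits K (fun v => π v ω) a) ∂P := by
    rw [← hπ.integral_mul_left (digitalShift h) hmeas]
    simp only [scrambledDigits_digitalShift_mul]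
  -- Averaging over all shifts `h` replaces the random argument by the whole group.
  calc _ = ∑ h : Fin d → Fin K → Fin b, ∫ ω, φ (scrambledDigits K (fun v => π v ω) a) ∂P := by
        simp
    _ = ∑ h : Fin d → Fin K → Fin b, ∫ ω, φ (h + scrambledDigits K (fun v => π v ω) a) ∂P :=
        Finset.sum_congr rfl fun h _ => key h
    _ = ∫ ω, ∑ h : Fin d → Fin K → Fin b, φ (h + scrambledDigits K (fun v => π v ω) a) ∂P := by
        rw [integral_finsetSum]
        intro h _
        exact (Integrable.of_finite (μ := P.map fun ω => scrambledDigits K (fun v => π v ω) a)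
          (f := fun y => φ (h + y))).comp_measurable (measurable_scrambledDigits_comp hπ a)
    _ = ∫ ω, ∑ y, φ y ∂P := by
        congr 1 with ω
        exact Equiv.sum_comp (Equiv.addRight _) φ
    _ = _ := by simp

/-- Distinct characters of scrambled digits are uncorrelated, also for different points. -/
lemma integral_char_mul_conj_char (hπ : IsUniformPermutations P b d π) (a a' : Fin d → ℝ)
    {χ ψ : AddChar (Fin d → Fin K → Fin b) ℂ} (hne : χ ≠ ψ) :
    ∫ ω, χ (scrambledDigits K (fun v => π v ω) a) *
      conj (ψ (scrambledDigits K (fun v => π v ω) a')) ∂P = 0 := by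
  obtain ⟨h, hh⟩ : ∃ h, χ h ≠ ψ h := by
    by_contra! hcon
    exact hne (DFunLike.ext _ _ hcon)
  have hmeas : Measurable fun π =>
      χ (scrambledDigits K π a) * conj (ψ (scrambledDigits K π a')) :=
    ((measurable_of_countable χ).comp (measurable_scrambledDigits a)).mul
      ((measurable_of_countable fun y => conj (ψ y)).comp (measurable_scrambledDigits a'))
  have key := hπ.integral_mul_left (digitalShift h) hmeas
  simp only [scrambledDigits_digitalShift_mul, AddChar.map_add_eq_mul, map_mul] at key
  have hcalc : ∀ ω, χ h * χ (scrambledDigits K (fun v => π v ω) a) *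
      (conj (ψ h) * conj (ψ (scrambledDigits K (fun v => π v ω) a'))) =
      (χ h * conj (ψ h)) * (χ (scrambledDigits K (fun v => π v ω) a) *
      conj (ψ (scrambledDigits K (fun v => π v ω) a'))) := fun ω => by ring
  simp only [hcalc] at key
  rw [integral_const_mul] at key
  -- Shifting by `h` multiplies the integral by this factor. Since `ψ h` has modulus one, the factor
  -- is one only if `χ h = ψ h`.
  have h1 : χ h * conj (ψ h) ≠ 1 := by
    intro h1
    apply hh
    have h2 : ψ h * conj (ψ h) = 1 := by
      rw [Complex.mul_conj, Complex.normSq_eq_norm_sq, AddChar.norm_apply]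
      simp
    have h3 : conj (ψ h) ≠ 0 := right_ne_zero_of_mul_eq_one h2
    exact mul_right_cancel₀ h3 (h1.trans h2.symm)
  by_contra h0
  exact h1 (mul_right_cancel₀ h0 (key.trans (one_mul _).symm))

end Digits

end ScrambledNet

/-! ### Second moments of characters and gain coefficients -/

namespace ScrambledNet

variable {Ω : Type*} [MeasurableSpace Ω] {P : Measure Ω} {b d K : ℕ} [NeZero b]

/-- The restriction of a character to digit `l` of coordinate `j`. -/
noncomputable def digitChar (χ : AddChar (Fin d → Fin K → Fin b) ℂ) (j : Fin d) (l : Fin K) :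
    AddChar (Fin b) ℂ :=
  χ.compAddMonoidHom ((AddMonoidHom.single (fun _ : Fin d => Fin K → Fin b) j).comp
    (AddMonoidHom.single (fun _ : Fin K => Fin b) l))

lemma digitChar_apply (χ : AddChar (Fin d → Fin K → Fin b) ℂ) (j : Fin d) (l : Fin K) (h : Fin b) :
    digitChar χ j l h = χ (Pi.single j (Pi.single l h)) := rfl

lemma char_eq_prod_digitChar (χ : AddChar (Fin d → Fin K → Fin b) ℂ)
    (y : Fin d → Fin K → Fin b) : χ y = ∏ j, ∏ l, digitChar χ j l (y j l) := by
  have hy : y = ∑ j, ∑ l, Pi.single j (Pi.single l (y j l)) := by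
    conv_lhs => rw [← Finset.univ_sum_single y]
    refine Finset.sum_congr rfl fun j _ => ?_
    conv_lhs => rw [← Finset.univ_sum_single (y j)]
    exact map_sum (AddMonoidHom.single (fun _ : Fin d => Fin K → Fin b) j) _ _
  conv_lhs => rw [hy]
  have hsum {ι : Type} (s : Finset ι) (g : ι → Fin d → Fin K → Fin b) :
      χ (∑ i ∈ s, g i) = ∏ i ∈ s, χ (g i) :=
    map_prod χ.toMonoidHom (fun i => Multiplicative.ofAdd (g i)) s
  simp only [hsum, digitChar_apply]

/-- A nontrivial character has a nonempty set of coordinates on which it is nontrivial, and on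
each of these a last digit on which it is nontrivial. -/
lemma exists_last_digit {χ : AddChar (Fin d → Fin K → Fin b) ℂ} (hχ : χ ≠ 1) :
    ∃ (u : Finset (Fin d)) (k : Fin d → ℕ), u.Nonempty ∧
      (∀ j ∈ u, ∃ l : Fin K, (l : ℕ) = k j ∧ digitChar χ j l ≠ 1) ∧
      (∀ j ∉ u, ∀ l, digitChar χ j l = 1) ∧
      ∀ j ∈ u, ∀ l : Fin K, k j < l → digitChar χ j l = 1 := by
  classical
  let S (j : Fin d) : Finset (Fin K) := Finset.univ.filter fun l => digitChar χ j l ≠ 1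
  have hS {j l} : l ∈ S j ↔ digitChar χ j l ≠ 1 := by simp [S]
  -- The default `0` outside `u` is harmless, as `k` is only constrained on `u`.
  refine ⟨Finset.univ.filter fun j => (S j).Nonempty,
    fun j => if h : (S j).Nonempty then ((S j).max' h : ℕ) else 0, ?_, ?_, ?_, ?_⟩
  · by_contra! hemp
    refine hχ (DFunLike.ext _ _ fun y => ?_)
    rw [char_eq_prod_digitChar, AddChar.one_apply]
    refine Finset.prod_eq_one fun j _ => Finset.prod_eq_one fun l _ => ?_
    have : ¬ (S j).Nonempty := fun h =>
      Finset.notMem_empty j (hemp ▸ Finset.mem_filter.2 ⟨Finset.mem_univ _, h⟩)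
    have hl : digitChar χ j l = 1 := by
      by_contra hl
      exact this ⟨l, hS.2 hl⟩
    rw [hl, AddChar.one_apply]
  · intro j hj
    have hj' : (S j).Nonempty := (Finset.mem_filter.1 hj).2
    exact ⟨(S j).max' hj', by simp [hj'], hS.1 ((S j).max'_mem hj')⟩
  · intro j hj l
    by_contra hl
    exact hj (Finset.mem_filter.2 ⟨Finset.mem_univ _, ⟨l, hS.2 hl⟩⟩)
  · intro j hj l hl
    have hj' : (S j).Nonempty := (Finset.mem_filter.1 hj).2
    simp only [dif_pos hj'] at hl
    by_contra hl'
    exact absurd ((S j).le_max' l (hS.2 hl')) (not_le.2 hl)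

/-- The average of a nontrivial character over the differences of the images of two points under
uniform permutations. -/
lemma sum_perm_char_sub (hb : 2 ≤ b) {c : AddChar (Fin b) ℂ} (hc : c ≠ 1) {p q : Fin b}
    (hpq : p ≠ q) :
    (b.factorial : ℂ)⁻¹ * ∑ σ : Equiv.Perm (Fin b), c (σ p - σ q) = -1 / ((b : ℂ) - 1) := by
  -- Precomposing with a transposition shows that all `q' ≠ p` give the same sum `S`. The sum over
  -- all `q'` vanishes by orthogonality, and `q' = p` contributes `b!`, so `b! + (b - 1) S = 0`.
  have hswap (q' : Fin b) (hq' : q' ≠ p) : ∑ σ : Equiv.Perm (Fin b), c (σ p - σ q') =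
      ∑ σ : Equiv.Perm (Fin b), c (σ p - σ q) := by
    rw [← Equiv.sum_comp (Equiv.mulRight (Equiv.swap q q'))
      fun σ : Equiv.Perm (Fin b) => c (σ p - σ q)]
    refine Finset.sum_congr rfl fun σ _ => ?_
    simp [Equiv.swap_apply_of_ne_of_ne hpq hq'.symm]
  have htot : ∑ q', ∑ σ : Equiv.Perm (Fin b), c (σ p - σ q') = 0 := by
    rw [Finset.sum_comm]
    refine Finset.sum_eq_zero fun σ _ => ?_
    rw [Equiv.sum_comp σ fun y => c (σ p - y)]
    exact (Equiv.sum_comp (Equiv.subLeft (σ p)) c).trans (AddChar.sum_eq_zero_of_ne_one hc)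
  rw [← Finset.add_sum_erase _ _ (Finset.mem_univ p),
    Finset.sum_congr rfl fun q' hq' => hswap q' (Finset.ne_of_mem_erase hq')] at htot
  simp only [sub_self, AddChar.map_zero_eq_one, Finset.sum_const, Finset.card_univ,
    Fintype.card_perm, Fintype.card_fin, Finset.card_erase_of_mem (Finset.mem_univ p),
    nsmul_eq_mul, mul_one] at htot
  rw [Nat.cast_sub (by lia)] at htot
  have hb1 : (b : ℂ) - 1 ≠ 0 := by
    rw [sub_ne_zero]
    exact_mod_cast (by lia : b ≠ 1)
  have hf : (b.factorial : ℂ) ≠ 0 := by exact_mod_cast b.factorial_ne_zero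
  field_simp
  push_cast at htot
  linear_combination htot

variable [IsProbabilityMeasure P] {π : Fin d × List (Fin b) → Ω → Equiv.Perm (Fin b)}

/-- The digits of `x` and `y` in base `b` agree up to position `n`. -/
def DigitsAgree (b : ℕ) [NeZero b] (n : ℕ) (x y : ℝ) : Prop :=
  ∀ l < n, Real.digits x b l = Real.digits y b l

-- If the first `k j` digits agree for all `j ∈ u`, both points use the same permutations through
-- digit `k j`: earlier digits cancel, later ones carry trivial characters, and the remaining
-- factors are independent over `j`, with mean `1` or `-1 / (b - 1)` according to whether digit `k
-- j` agrees too. If some coordinate separates earlier, the permutation at its last nontrivial digit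
-- acts on `a` alone and averages the character to zero.
open Classical in
lemma integral_char_sub (hb : 2 ≤ b) (hπ : IsUniformPermutations P b d π)
    {χ : AddChar (Fin d → Fin K → Fin b) ℂ} {u : Finset (Fin d)} {k : Fin d → ℕ}
    (hlast : ∀ j ∈ u, ∃ l : Fin K, (l : ℕ) = k j ∧ digitChar χ j l ≠ 1)
    (hout : ∀ j ∉ u, ∀ l, digitChar χ j l = 1)
    (htriv : ∀ j ∈ u, ∀ l : Fin K, k j < l → digitChar χ j l = 1) (a a' : Fin d → ℝ) :
    ∫ ω, χ (scrambledDigits K (fun v => π v ω) a - scrambledDigits K (fun v => π v ω) a') ∂P =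
      ∏ j ∈ u, (((b : ℂ) * (if DigitsAgree b (k j + 1) (a j) (a' j) then 1 else 0)
        - (if DigitsAgree b (k j) (a j) (a' j) then 1 else 0)) / ((b : ℂ) - 1)) := by
  have hb1 : (b : ℂ) - 1 ≠ 0 := by
    rw [sub_ne_zero]
    exact_mod_cast (by lia : b ≠ 1)
  by_cases hagree : ∀ j ∈ u, DigitsAgree b (k j) (a j) (a' j)
  · have hpoint (ω) :
        χ (scrambledDigits K (fun v => π v ω) a - scrambledDigits K (fun v => π v ω) a') =
        ∏ j, (if hj : j ∈ u then digitChar χ j (hlast j hj).choose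
          (π (node b a j (k j)) ω (Real.digits (a j) b (k j)) -
            π (node b a j (k j)) ω (Real.digits (a' j) b (k j))) else 1) := by
      rw [char_eq_prod_digitChar]
      refine Finset.prod_congr rfl fun j _ => ?_
      split_ifs with hj
      · have hl := (hlast j hj).choose_spec.1
        have hnode : ∀ l ≤ k j, node b a' j l = node b a j l := fun l hl =>
          node_eq_node_iff.2 ⟨rfl, rfl, fun i hi => (hagree j hj i (hi.trans_le hl)).symm⟩
        rw [Finset.prod_eq_single (hlast j hj).choose]
        · simp only [Pi.sub_apply, scrambledDigits, hl, hnode _ le_rfl]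
        · intro l _ hne
          rcases lt_or_gt_of_ne (fun h => hne (Fin.ext (h.trans hl.symm)) : (l : ℕ) ≠ k j)
            with h | h
          · simp [scrambledDigits, hnode l h.le, hagree j hj l h]
          · rw [htriv j hj l h, AddChar.one_apply]
        · simp
      · exact Finset.prod_eq_one fun l _ => by rw [hout j hj l, AddChar.one_apply]
    have hind : iIndepFun (fun (j : Fin d) (ω : Ω) =>
        (if hj : j ∈ u then digitChar χ j (hlast j hj).choose
          (π (node b a j (k j)) ω (Real.digits (a j) b (k j)) -
            π (node b a j (k j)) ω (Real.digits (a' j) b (k j))) else 1)) P := by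
      refine (hπ.indep.precomp (g := fun j => node b a j (k j))
        fun j j' h => (node_eq_node_iff.1 h).1).comp
        (fun (j : Fin d) (τ : Equiv.Perm (Fin b)) =>
          (if hj : j ∈ u then digitChar χ j (hlast j hj).choose
            (τ (Real.digits (a j) b (k j)) - τ (Real.digits (a' j) b (k j))) else (1 : ℂ)))
        fun j => Measurable.of_discrete
    simp_rw [hpoint]
    rw [hind.integral_fun_prod_eq_prod_integral]
    swap
    · intro j
      exact ((Measurable.of_discrete (f := fun τ : Equiv.Perm (Fin b) =>
          (if hj : j ∈ u then digitChar χ j (hlast j hj).choose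
            (τ (Real.digits (a j) b (k j)) - τ (Real.digits (a' j) b (k j))) else (1 : ℂ)))).comp
        (hπ.measurable_apply _)).aestronglyMeasurable
    rw [← Finset.prod_subset (Finset.subset_univ u)
      (fun j _ hj => by simp only [dif_neg hj]; simp)]
    refine Finset.prod_congr rfl fun j hj => ?_
    simp only [dif_pos hj]
    rw [hπ.integral_apply (node b a j (k j)) fun τ => digitChar χ j (hlast j hj).choose
      (τ (Real.digits (a j) b (k j)) - τ (Real.digits (a' j) b (k j))), if_pos (hagree j hj)]
    split_ifs with hnext
    · have : Real.digits (a j) b (k j) = Real.digits (a' j) b (k j) := hnext _ (Nat.lt_succ_self _)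
      have hf : (b.factorial : ℂ) ≠ 0 := by exact_mod_cast b.factorial_ne_zero
      simp [this, Fintype.card_perm, hf, hb1]
    · have : Real.digits (a j) b (k j) ≠ Real.digits (a' j) b (k j) := by
        intro heq
        refine hnext fun l hl => ?_
        rcases Nat.lt_succ_iff_lt_or_eq.1 hl with h | rfl
        · exact hagree j hj l h
        · exact heq
      rw [sum_perm_char_sub hb (hlast j hj).choose_spec.2 this]
      simp
  · push Not at hagree
    obtain ⟨j, hj, hdis⟩ := hagree
    have hdis' : ¬ DigitsAgree b (k j + 1) (a j) (a' j) :=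
      fun h => hdis fun l hl => h l (hl.trans (Nat.lt_succ_self _))
    rw [Finset.prod_eq_zero hj (by simp [hdis, hdis'])]
    obtain ⟨l, hl, hchar⟩ := hlast j hj
    obtain ⟨h, hh⟩ : ∃ h, digitChar χ j l h ≠ 1 := by
      by_contra! hcon
      exact hchar (DFunLike.ext _ _ hcon)
    -- Only the permutation at the last nontrivial digit of `a` is shifted; `a'` never meets this
    -- node because its prefix differs.
    let σ : Fin d × List (Fin b) → Equiv.Perm (Fin b) :=
      fun v => if v = node b a j (k j) then Equiv.addLeft h else 1
    have hmeas : Measurable fun π => χ (scrambledDigits K π a - scrambledDigits K π a') :=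
      (measurable_of_countable fun y : (Fin d → Fin K → Fin b) × (Fin d → Fin K → Fin b) =>
        χ (y.1 - y.2)).comp ((measurable_scrambledDigits a).prodMk (measurable_scrambledDigits a'))
    have key := hπ.integral_mul_left σ hmeas
    have ha (ρ : Fin d × List (Fin b) → Equiv.Perm (Fin b)) :
        scrambledDigits K (fun v => σ v * ρ v) a =
          Pi.single j (Pi.single l h) + scrambledDigits K ρ a := by
      ext j' l' : 2
      by_cases hj' : j' = j
      · subst hj'
        by_cases hl' : l' = l
        · subst hl'
          simp [scrambledDigits, σ, hl]
        · have : node b a j' l' ≠ node b a j' (k j') := fun h =>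
            hl' (Fin.ext ((node_eq_node_iff.1 h).2.1.trans hl.symm))
          simp [scrambledDigits, σ, this, hl']
      · have : node b a j' l' ≠ node b a j (k j) := fun h => hj' (node_eq_node_iff.1 h).1
        simp [scrambledDigits, σ, this, hj']
    have ha' (ρ : Fin d × List (Fin b) → Equiv.Perm (Fin b)) :
        scrambledDigits K (fun v => σ v * ρ v) a' = scrambledDigits K ρ a' := by
      ext j' l' : 2
      have : node b a' j' l' ≠ node b a j (k j) := by
        intro h
        obtain ⟨rfl, h1, h2⟩ := node_eq_node_iff.1 h
        exact hdis fun i hi => (h2 i (h1 ▸ hi)).symm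
      simp [scrambledDigits, σ, this]
    simp only [ha, ha', add_sub_assoc, AddChar.map_add_eq_mul] at key
    rw [integral_const_mul] at key
    by_contra h0
    exact hh (mul_right_cancel₀ h0 (key.trans (one_mul _).symm))

/-- The integer `⌊b ^ n x⌋` encodes the first `n` digits. This turns the indicators of the gain
coefficient into the agreement of digits that governs shared permutations. -/
lemma floor_eq_floor_iff_digitsAgree {x y : ℝ} (hx : x ∈ Set.Ico (0 : ℝ) 1)
    (hy : y ∈ Set.Ico (0 : ℝ) 1) (n : ℕ) :
    ⌊(b : ℝ) ^ n * x⌋ = ⌊(b : ℝ) ^ n * y⌋ ↔ DigitsAgree b n x y := by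
  have hb0 := NeZero.pos b
  have hx0 : 0 ≤ (b : ℝ) ^ n * x := mul_nonneg (by positivity) hx.1
  have hy0 : 0 ≤ (b : ℝ) ^ n * y := mul_nonneg (by positivity) hy.1
  rw [← Int.natCast_floor_eq_floor hx0, ← Int.natCast_floor_eq_floor hy0, Nat.cast_inj]
  constructor
  · intro h l hl
    have key (z : ℝ) : ⌊z * (b : ℝ) ^ (l + 1)⌋₊ = ⌊(b : ℝ) ^ n * z⌋₊ / b ^ (n - (l + 1)) := by
      rw [← Nat.floor_div_natCast]
      congr 1
      push_cast
      rw [eq_div_iff (by positivity), mul_assoc, ← pow_add, mul_comm]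
      congr 2
      lia
    simp only [Real.digits, key, h]
  · intro h
    have h1 := Real.ofDigits_digits_sum_eq (b := b) hx n
    have h2 := Real.ofDigits_digits_sum_eq (b := b) hy n
    have : ∑ i ∈ Finset.range n, Real.ofDigitsTerm (Real.digits x b) i =
        ∑ i ∈ Finset.range n, Real.ofDigitsTerm (Real.digits y b) i :=
      Finset.sum_congr rfl fun i hi => by
        simp only [Real.ofDigitsTerm, h i (Finset.mem_range.1 hi)]
    rw [this, h2] at h1
    exact_mod_cast h1.symm

/-- The second moment of the sum of a nontrivial character over scrambled points is given by a
gain coefficient. -/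
lemma exists_integral_sum_char_mul_conj {n : ℕ} (hb : 2 ≤ b) (hπ : IsUniformPermutations P b d π)
    {χ : AddChar (Fin d → Fin K → Fin b) ℂ} (hχ : χ ≠ 1) {x : Fin n → Fin d → ℝ}
    (hx : ∀ i j, x i j ∈ Set.Ico (0 : ℝ) 1) :
    ∃ (u : Finset (Fin d)) (k : Fin d → ℕ), u.Nonempty ∧
      ∑ i, ∑ i', ∫ ω, χ (scrambledDigits K (fun v => π v ω) (x i)) *
        conj (χ (scrambledDigits K (fun v => π v ω) (x i'))) ∂P =
        ((n * gainCoefficient b x u k : ℝ) : ℂ) := by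
  obtain ⟨u, k, hu, hlast, hout, htriv⟩ := exists_last_digit hχ
  refine ⟨u, k, hu, ?_⟩
  rcases Nat.eq_zero_or_pos n with rfl | hn
  · simp
  classical
  simp_rw [← AddChar.map_neg_eq_conj, ← AddChar.map_add_eq_mul, ← sub_eq_add_neg,
    integral_char_sub hb hπ hlast hout htriv]
  have hb1 : (b : ℝ) - 1 ≠ 0 := by
    rw [sub_ne_zero]
    exact_mod_cast (by lia : b ≠ 1)
  have hn' : (n : ℝ) ≠ 0 := by positivity
  have hgain : n * gainCoefficient b x u k = ∑ i, ∑ i', ∏ j ∈ u,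
      (((b : ℝ) * (if DigitsAgree b (k j + 1) (x i j) (x i' j) then 1 else 0)
        - (if DigitsAgree b (k j) (x i j) (x i' j) then 1 else 0)) / ((b : ℝ) - 1)) := by
    simp only [gainCoefficient, floor_eq_floor_iff_digitsAgree (hx _ _) (hx _ _),
      Finset.prod_div_distrib, Finset.prod_const, ← Finset.sum_div]
    field_simp
  rw [hgain]
  push_cast [apply_ite]
  rfl

end ScrambledNet

/-! ### Fourier expansion and the variance for finitely many digits -/

namespace ScrambledNet

section Characters

variable {G : Type*} [AddCommGroup G] [Fintype G]

lemma sum_char_mul_conj (χ ψ : AddChar G ℂ) [Decidable (χ = ψ)] :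
    ∑ y, χ y * conj (ψ y) = if χ = ψ then (Fintype.card G : ℂ) else 0 := by
  have h : ∀ y, χ y * conj (ψ y) = (χ * ψ⁻¹) y := fun y => by
    rw [AddChar.mul_apply, AddChar.inv_apply, AddChar.map_neg_eq_conj]
  simp_rw [h]
  split_ifs with hχ
  · simp [hχ]
  · exact AddChar.sum_eq_zero_of_ne_one fun h1 => hχ (mul_inv_eq_one.1 h1)

/-- Both identities follow from orthogonality. The first makes `c 1` the mean; the second is
Parseval's identity, which converts a bound for each character into one by the `L²` norm. -/
lemma exists_char_expansion (φ : G → ℂ) :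
    ∃ c : AddChar G ℂ → ℂ, (∀ y, φ y = ∑ χ, c χ * χ y) ∧
      ∑ y, φ y = Fintype.card G * c 1 ∧
      ∑ y, φ y * conj (φ y) = Fintype.card G * ∑ χ, c χ * conj (c χ) := by
  classical
  let c := (AddChar.complexBasis G).repr φ
  have hφ (y) : φ y = ∑ χ, c χ * χ y := by
    conv_lhs => rw [← (AddChar.complexBasis G).sum_repr φ]
    simp [c]
  refine ⟨c, hφ, ?_, ?_⟩
  · have h := fun χ : AddChar G ℂ => sum_char_mul_conj χ 1
    simp only [AddChar.one_apply, map_one, mul_one] at h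
    simp_rw [hφ]
    rw [Finset.sum_comm]
    simp_rw [← Finset.mul_sum, h]
    simp [mul_comm]
  · simp_rw [hφ, map_sum, Finset.sum_mul_sum, map_mul]
    rw [Finset.sum_comm, Finset.mul_sum]
    refine Finset.sum_congr rfl fun χ _ => ?_
    rw [Finset.sum_comm]
    have h (ψ : AddChar G ℂ) : ∑ y, c χ * χ y * (conj (c ψ) * conj (ψ y)) =
        c χ * conj (c ψ) * if χ = ψ then (Fintype.card G : ℂ) else 0 := by
      rw [← sum_char_mul_conj, Finset.mul_sum]
      exact Finset.sum_congr rfl fun y _ => by ring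
    simp_rw [h]
    simp
    ring

end Characters

variable {Ω : Type*} [MeasurableSpace Ω] {P : Measure Ω} [IsProbabilityMeasure P] {b d K n : ℕ}
  [NeZero b] {π : Fin d × List (Fin b) → Ω → Equiv.Perm (Fin b)}

lemma integrable_scrambledDigits_pair (hπ : IsUniformPermutations P b d π) (a a' : Fin d → ℝ)
    (F : (Fin d → Fin K → Fin b) × (Fin d → Fin K → Fin b) → ℂ) :
    Integrable (fun ω => F (scrambledDigits K (fun v => π v ω) a,
      scrambledDigits K (fun v => π v ω) a')) P :=
  (Integrable.of_finite (μ := P.map fun ω => (scrambledDigits K (fun v => π v ω) a,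
    scrambledDigits K (fun v => π v ω) a')) (f := F)).comp_measurable
    ((measurable_scrambledDigits_comp hπ a).prodMk (measurable_scrambledDigits_comp hπ a'))

/-- The variance bound for functions of finitely many digits. -/
lemma integral_sq_sum_scrambledDigits_le (hb : 2 ≤ b) (hπ : IsUniformPermutations P b d π)
    {x : Fin n → Fin d → ℝ} (hx : ∀ i j, x i j ∈ Set.Ico (0 : ℝ) 1) {Γ : ℝ}
    (hΓ : ∀ u : Finset (Fin d), u.Nonempty → ∀ k, gainCoefficient b x u k ≤ Γ)
    {φ : (Fin d → Fin K → Fin b) → ℝ} (hφ : ∑ y, φ y = 0) :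
    ∫ ω, (∑ i, φ (scrambledDigits K (fun v => π v ω) (x i))) ^ 2 ∂P ≤
      n * Γ * ((Fintype.card (Fin d → Fin K → Fin b) : ℝ)⁻¹ * ∑ y, φ y ^ 2) := by
  classical
  obtain ⟨c, hc, hc1, hc2⟩ := exists_char_expansion fun y => (φ y : ℂ)
  have hcard : (Fintype.card (Fin d → Fin K → Fin b) : ℂ) ≠ 0 := by
    exact_mod_cast Fintype.card_ne_zero
  have hcard' : (Fintype.card (Fin d → Fin K → Fin b) : ℝ) ≠ 0 := by
    exact_mod_cast Fintype.card_ne_zero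
  have hc0 : c 1 = 0 := by
    rw [← Complex.ofReal_sum, hφ] at hc1
    exact (mul_eq_zero.1 (hc1.symm.trans Complex.ofReal_zero)).resolve_left hcard
  let X (i : Fin n) (ω : Ω) := scrambledDigits K (fun v => π v ω) (x i)
  let V (χ ψ : AddChar (Fin d → Fin K → Fin b) ℂ) : ℂ :=
    ∑ i, ∑ i', ∫ ω, χ (X i ω) * conj (ψ (X i' ω)) ∂P
  have hV0 {χ ψ} (h : χ ≠ ψ) : V χ ψ = 0 :=
    Finset.sum_eq_zero fun i _ => Finset.sum_eq_zero fun i' _ =>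
      integral_char_mul_conj_char hπ (x i) (x i') h
  have hV1 {χ} (h : χ ≠ 1) : ∃ g ≤ n * Γ, V χ χ = ((g : ℝ) : ℂ) := by
    obtain ⟨u, k, hu, h⟩ := exists_integral_sum_char_mul_conj hb hπ h hx
    exact ⟨_, mul_le_mul_of_nonneg_left (hΓ u hu k) (Nat.cast_nonneg n), h⟩
  -- Only the diagonal survives, since distinct characters are uncorrelated at every pair of points.
  have hreal : ((∫ ω, (∑ i, φ (X i ω)) ^ 2 ∂P : ℝ) : ℂ) = ∑ χ, c χ * conj (c χ) * V χ χ := by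
    rw [← integral_complex_ofReal]
    have hpt (ω) : (((∑ i, φ (X i ω)) ^ 2 : ℝ) : ℂ) = ∑ i, ∑ i', ∑ χ, ∑ ψ,
        c χ * conj (c ψ) * (χ (X i ω) * conj (ψ (X i' ω))) := by
      rw [sq]
      push_cast
      rw [Finset.sum_mul_sum]
      refine Finset.sum_congr rfl fun i _ => Finset.sum_congr rfl fun i' _ => ?_
      conv_lhs => rw [← Complex.conj_ofReal (φ (X i' ω)), hc, hc, map_sum, Finset.sum_mul_sum]
      refine Finset.sum_congr rfl fun χ _ => Finset.sum_congr rfl fun ψ _ => ?_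
      rw [map_mul]
      ring
    have hint (i i') (χ ψ : AddChar (Fin d → Fin K → Fin b) ℂ) : Integrable
        (fun ω => c χ * conj (c ψ) * (χ (X i ω) * conj (ψ (X i' ω)))) P :=
      integrable_scrambledDigits_pair hπ (x i) (x i')
        fun y => c χ * conj (c ψ) * (χ y.1 * conj (ψ y.2))
    simp_rw [hpt]
    rw [integral_finsetSum _ fun i _ => integrable_finsetSum _ fun i' _ =>
      integrable_finsetSum _ fun χ _ => integrable_finsetSum _ fun ψ _ => hint i i' χ ψ]
    calc _ = ∑ i, ∑ i', ∑ χ, ∑ ψ, c χ * conj (c ψ) * ∫ ω, χ (X i ω) * conj (ψ (X i' ω)) ∂P := by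
          refine Finset.sum_congr rfl fun i _ => ?_
          rw [integral_finsetSum _ fun i' _ =>
            integrable_finsetSum _ fun χ _ => integrable_finsetSum _ fun ψ _ => hint i i' χ ψ]
          refine Finset.sum_congr rfl fun i' _ => ?_
          rw [integral_finsetSum _ fun χ _ => integrable_finsetSum _ fun ψ _ => hint i i' χ ψ]
          refine Finset.sum_congr rfl fun χ _ => ?_
          rw [integral_finsetSum _ fun ψ _ => hint i i' χ ψ]
          exact Finset.sum_congr rfl fun ψ _ => integral_const_mul _ _
      _ = ∑ χ, ∑ ψ, c χ * conj (c ψ) * V χ ψ := by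
          simp only [V, Finset.mul_sum]
          rw [Finset.sum_congr rfl fun i _ => Finset.sum_comm, Finset.sum_comm]
          refine Finset.sum_congr rfl fun χ _ => ?_
          rw [Finset.sum_congr rfl fun i _ => Finset.sum_comm, Finset.sum_comm]
      _ = _ := Finset.sum_congr rfl fun χ _ =>
          Finset.sum_eq_single χ (fun ψ _ h => by rw [hV0 h.symm, mul_zero]) (by simp)
  have hsum : ∑ χ, ‖c χ‖ ^ 2 =
      (Fintype.card (Fin d → Fin K → Fin b) : ℝ)⁻¹ * ∑ y, φ y ^ 2 := by
    rw [eq_inv_mul_iff_mul_eq₀ hcard', ← Complex.ofReal_inj]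
    push_cast
    simp_rw [← Complex.mul_conj']
    rw [← hc2]
    simp [sq]
  have hre : ∫ ω, (∑ i, φ (X i ω)) ^ 2 ∂P = ∑ χ, ‖c χ‖ ^ 2 * (V χ χ).re := by
    rw [← Complex.ofReal_re (∫ ω, (∑ i, φ (X i ω)) ^ 2 ∂P), hreal, Complex.re_sum]
    refine Finset.sum_congr rfl fun χ _ => ?_
    rw [Complex.mul_conj', ← Complex.ofReal_pow, Complex.re_ofReal_mul]
  rw [← hsum, Finset.mul_sum]
  refine hre.trans_le (Finset.sum_le_sum fun χ _ => ?_)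
  -- The trivial character has `V 1 1 = n²`, outside the reach of `Γ`, but its coefficient is the
  -- mean of `φ`, which is zero.
  by_cases h : χ = 1
  · simp [h, hc0]
  · obtain ⟨g, hg, hVg⟩ := hV1 h
    rw [hVg, Complex.ofReal_re, mul_comm]
    exact mul_le_mul_of_nonneg_right hg (sq_nonneg _)

end ScrambledNet

/-! ### From digits to points: uniform distribution and continuous functions -/

namespace ScrambledNet

variable {Ω : Type*} [MeasurableSpace Ω] {P : Measure Ω} {b d K n : ℕ}

lemma abs_ofDigits_sub_sum_le (w : ℕ → Fin b) (K : ℕ) :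
    |Real.ofDigits w - ∑ l : Fin K, (w l : ℝ) * ((b : ℝ) ^ ((l : ℕ) + 1))⁻¹| ≤ ((b : ℝ) ^ K)⁻¹ := by
  rw [Real.ofDigits_eq_sum_add_ofDigits w K, Finset.sum_range]
  simp only [Real.ofDigitsTerm, add_sub_cancel_left]
  rw [abs_of_nonneg (mul_nonneg (by positivity) (Real.ofDigits_nonneg _))]
  exact mul_le_of_le_one_right (by positivity) (Real.ofDigits_le_one _)

/-- The point whose coordinates have the given `K` digits, followed by zeros. -/
noncomputable def digitPoint (y : Fin d → Fin K → Fin b) : Fin d → ℝ :=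
  fun j => ∑ l : Fin K, (y j l : ℝ) * ((b : ℝ) ^ ((l : ℕ) + 1))⁻¹

lemma tendsto_digitPoint (hb : 2 ≤ b) (w : Fin d → ℕ → Fin b) :
    Tendsto (fun K => digitPoint fun j (l : Fin K) => w j l) atTop
      (𝓝 fun j => Real.ofDigits (w j)) := by
  refine tendsto_pi_nhds.2 fun j => ?_
  rw [tendsto_iff_dist_tendsto_zero]
  refine squeeze_zero (g := fun K => ((b : ℝ) ^ K)⁻¹) (fun _ => dist_nonneg)
    (fun K => by rw [dist_comm]; exact abs_ofDigits_sub_sum_le (w j) K) ?_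
  simp_rw [← inv_pow]
  exact tendsto_pow_atTop_nhds_zero_of_lt_one (by positivity)
    (inv_lt_one_of_one_lt₀ (by exact_mod_cast hb))

lemma measurable_digitPoint : Measurable (digitPoint (b := b) (d := d) (K := K)) :=
  measurable_of_countable _

variable [NeZero b]

lemma tendsto_digitPoint_scrambledDigits (hb : 2 ≤ b)
    (π : Fin d × List (Fin b) → Equiv.Perm (Fin b)) (a : Fin d → ℝ) :
    Tendsto (fun K => digitPoint (scrambledDigits K π a)) atTop (𝓝 (scramble π a)) :=
  tendsto_digitPoint hb fun j l => π (node b a j l) (Real.digits (a j) b l)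

/-- The first `K` digits of the coordinates of a point. -/
noncomputable def expansion (b K : ℕ) [NeZero b] (x : Fin d → ℝ) : Fin d → Fin K → Fin b :=
  fun j l => Real.digits (x j) b l

lemma measurable_expansion : Measurable (expansion (d := d) b K) := by
  refine measurable_pi_lambda _ fun j => measurable_pi_lambda _ fun l => ?_
  exact (Measurable.of_discrete (f := Fin.ofNat b)).comp
    (Nat.measurable_floor.comp ((measurable_pi_apply j).mul_const _))

lemma tendsto_digitPoint_expansion (hb : 2 ≤ b) {x : Fin d → ℝ}
    (hx : ∀ j, x j ∈ Set.Ico (0 : ℝ) 1) :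
    Tendsto (fun K => digitPoint (expansion b K x)) atTop (𝓝 x) := by
  have h := tendsto_digitPoint hb fun j l => Real.digits (x j) b l
  rwa [show (fun j => Real.ofDigits (Real.digits (x j) b)) = x from
    funext fun j => Real.ofDigits_digits (by lia) (hx j)] at h

/-- Lebesgue measure on the unit cube. -/
noncomputable abbrev cubeMeasure (d : ℕ) : Measure (Fin d → ℝ) :=
  volume.restrict (Set.Icc (0 : Fin d → ℝ) 1)

instance isProbabilityMeasure_cubeMeasure : IsProbabilityMeasure (cubeMeasure d) :=
  ⟨by simp [Real.volume_Icc_pi]⟩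

lemma ae_cubeMeasure_mem_Ico : ∀ᵐ x ∂cubeMeasure d, ∀ j, x j ∈ Set.Ico (0 : ℝ) 1 := by
  have h : cubeMeasure d = volume.restrict (Set.univ.pi fun _ => Set.Ico (0 : ℝ) 1) :=
    (Measure.restrict_congr_set Measure.univ_pi_Ico_ae_eq_Icc).symm
  rw [h]
  filter_upwards [ae_restrict_mem (MeasurableSet.univ_pi fun _ => measurableSet_Ico)] with x hx j
  exact hx j (Set.mem_univ j)

/-- Points with leading digits `y` lie in a cube of side `b ^ (-K)`. The upper bound suffices: total
mass one forces equality in `integral_expansion`. -/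
lemma cubeMeasure_real_expansion_le (y : Fin d → Fin K → Fin b) :
    (cubeMeasure d).real (expansion b K ⁻¹' {y}) ≤
      (Fintype.card (Fin d → Fin K → Fin b) : ℝ)⁻¹ := by
  have hle : cubeMeasure d (expansion b K ⁻¹' {y}) ≤
      volume (Set.Icc (digitPoint y) fun j => digitPoint y j + ((b : ℝ)⁻¹) ^ K) := by
    refine (measure_mono_ae ?_).trans (Measure.restrict_apply_le _ _)
    filter_upwards [ae_cubeMeasure_mem_Ico] with x hx hxy
    have hxy' : expansion b K x = y := hxy
    rw [← hxy']
    refine ⟨fun j => ?_, fun j => ?_⟩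
    · have := Real.sum_ofDigitsTerm_digits_le (b := b) (hx j) K
      rwa [Finset.sum_range] at this
    · have := Real.le_sum_ofDigitsTerm_digits (b := b) (hx j) K
      rw [Finset.sum_range] at this
      exact sub_le_iff_le_add.1 this
  rw [Real.volume_Icc_pi] at hle
  simp only [add_sub_cancel_left, Finset.prod_const, Finset.card_univ, Fintype.card_fin] at hle
  rw [← ENNReal.ofReal_pow (by positivity)] at hle
  refine (ENNReal.toReal_le_of_le_ofReal (by positivity) hle).trans_eq ?_
  simp

/-- The first `K` digits of a uniformly distributed point are uniformly distributed. -/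
lemma integral_expansion (φ : (Fin d → Fin K → Fin b) → ℝ) :
    ∫ x, φ (expansion b K x) ∂cubeMeasure d =
      (Fintype.card (Fin d → Fin K → Fin b) : ℝ)⁻¹ * ∑ y, φ y := by
  have hcard : (Fintype.card (Fin d → Fin K → Fin b) : ℝ) ≠ 0 := by
    exact_mod_cast Fintype.card_ne_zero
  have := Measure.isProbabilityMeasure_map (μ := cubeMeasure d)
    (measurable_expansion (b := b) (K := K)).aemeasurable
  have hle (y : Fin d → Fin K → Fin b) : ((cubeMeasure d).map (expansion b K)).real {y} ≤
      (Fintype.card (Fin d → Fin K → Fin b) : ℝ)⁻¹ := by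
    rw [map_measureReal_apply measurable_expansion (measurableSet_singleton y)]
    exact cubeMeasure_real_expansion_le y
  have hsum : ∑ y : Fin d → Fin K → Fin b, ((cubeMeasure d).map (expansion b K)).real {y} =
      ∑ y : Fin d → Fin K → Fin b, (Fintype.card (Fin d → Fin K → Fin b) : ℝ)⁻¹ := by
    rw [sum_measureReal_singleton, Finset.coe_univ, probReal_univ, Finset.sum_const,
      Finset.card_univ, nsmul_eq_mul, mul_inv_cancel₀ hcard]
  have heq := (Finset.sum_eq_sum_iff_of_le fun y _ => hle y).1 hsum
  rw [← integral_map (φ := expansion b K) measurable_expansion.aemeasurable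
    (measurable_of_countable φ).aestronglyMeasurable, integral_fintype Integrable.of_finite,
    Finset.mul_sum]
  exact Finset.sum_congr rfl fun y hy => by rw [heq y hy, smul_eq_mul]

variable {π : Fin d × List (Fin b) → Ω → Equiv.Perm (Fin b)}

lemma measurable_scramble (hb : 2 ≤ b) (hπ : IsUniformPermutations P b d π) (a : Fin d → ℝ) :
    Measurable fun ω => scramble (fun v => π v ω) a :=
  measurable_of_tendsto_metrizable
    (fun _ => measurable_digitPoint.comp (measurable_scrambledDigits_comp hπ a))
    (tendsto_pi_nhds.2 fun _ => tendsto_digitPoint_scrambledDigits hb _ a)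

/-- Averages of a bounded continuous function over digit grids converge to its integral. -/
lemma tendsto_average_digitPoint (hb : 2 ≤ b) {g : (Fin d → ℝ) → ℝ} (hg : Continuous g) {M : ℝ}
    (hM : ∀ x, |g x| ≤ M) :
    Tendsto (fun K => (Fintype.card (Fin d → Fin K → Fin b) : ℝ)⁻¹ *
      ∑ y : Fin d → Fin K → Fin b, g (digitPoint y)) atTop (𝓝 (∫ x, g x ∂cubeMeasure d)) := by
  simp_rw [← integral_expansion fun y => g (digitPoint y)]
  refine tendsto_integral_of_dominated_convergence (fun _ => M)
    (fun K => (hg.measurable.comp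
      (measurable_digitPoint.comp measurable_expansion)).aestronglyMeasurable)
    (integrable_const M) (fun K => ae_of_all _ fun x => hM _) ?_
  filter_upwards [ae_cubeMeasure_mem_Ico] with x hx
  exact (hg.tendsto x).comp (tendsto_digitPoint_expansion hb hx)

variable [IsProbabilityMeasure P]

/-- A scrambled point is uniformly distributed on the unit cube. -/
lemma measurePreserving_scramble (hb : 2 ≤ b) (hπ : IsUniformPermutations P b d π)
    (a : Fin d → ℝ) :
    MeasurePreserving (fun ω => scramble (fun v => π v ω) a) P (cubeMeasure d) := by
  refine ⟨measurable_scramble hb hπ a, ?_⟩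
  have := Measure.isProbabilityMeasure_map (μ := P) (measurable_scramble hb hπ a).aemeasurable
  refine ext_of_forall_integral_eq_of_IsFiniteMeasure fun g => ?_
  rw [integral_map (measurable_scramble hb hπ a).aemeasurable
    g.continuous.aestronglyMeasurable]
  have hlim : Tendsto (fun K => ∫ ω, g (digitPoint (scrambledDigits K (fun v => π v ω) a)) ∂P)
      atTop (𝓝 (∫ ω, g (scramble (fun v => π v ω) a) ∂P)) := by
    refine tendsto_integral_of_dominated_convergence (fun _ => ‖g‖)
      (fun K => (g.continuous.measurable.comp (measurable_digitPoint.comp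
        (measurable_scrambledDigits_comp hπ a))).aestronglyMeasurable)
      (integrable_const _) (fun K => ae_of_all _ fun x => g.norm_coe_le_norm _) ?_
    exact ae_of_all _ fun ω =>
      (g.continuous.tendsto _).comp (tendsto_digitPoint_scrambledDigits hb _ a)
  -- For each `K` the two approximations coincide, because the first `K` scrambled digits are
  -- uniform.
  refine tendsto_nhds_unique hlim ?_
  convert tendsto_average_digitPoint hb g.continuous g.norm_coe_le_norm using 2 with K
  have h := integral_scrambledDigits (K := K) hπ a fun y => (g (digitPoint y) : ℂ)
  rw [integral_complex_ofReal] at h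
  refine Complex.ofReal_injective (h.trans ?_)
  push_cast
  rfl

/-- The variance bound for bounded continuous functions. -/
lemma integral_sq_sum_scramble_le_of_continuous (hb : 2 ≤ b) (hπ : IsUniformPermutations P b d π)
    {x : Fin n → Fin d → ℝ} (hx : ∀ i j, x i j ∈ Set.Ico (0 : ℝ) 1) {Γ : ℝ} (hΓ0 : 0 ≤ Γ)
    (hΓ : ∀ u : Finset (Fin d), u.Nonempty → ∀ k, gainCoefficient b x u k ≤ Γ)
    {g : (Fin d → ℝ) → ℝ} (hg : Continuous g) {M : ℝ} (hM : ∀ x, |g x| ≤ M) :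
    ∫ ω, (∑ i, (g (scramble (fun v => π v ω) (x i)) - ∫ z, g z ∂cubeMeasure d)) ^ 2 ∂P ≤
      n * Γ * ∫ z, g z ^ 2 ∂cubeMeasure d := by
  -- Centring by the grid average instead of the integral makes the digit function sum to exactly
  -- zero for each `K`, as the finite variance bound requires.
  let avg (K : ℕ) (h : (Fin d → ℝ) → ℝ) : ℝ := (Fintype.card (Fin d → Fin K → Fin b) : ℝ)⁻¹ *
      ∑ y : Fin d → Fin K → Fin b, h (digitPoint y)
  have hcard (K : ℕ) : (Fintype.card (Fin d → Fin K → Fin b) : ℝ) ≠ 0 := by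
    exact_mod_cast Fintype.card_ne_zero
  have havg : Tendsto (fun K => avg K g) atTop (𝓝 (∫ z, g z ∂cubeMeasure d)) :=
    tendsto_average_digitPoint hb hg hM
  have havg2 : Tendsto (fun K => avg K fun z => g z ^ 2) atTop
      (𝓝 (∫ z, g z ^ 2 ∂cubeMeasure d)) :=
    tendsto_average_digitPoint hb (hg.pow 2) (M := M ^ 2) fun z => by
      rw [abs_pow]
      exact pow_le_pow_left₀ (abs_nonneg _) (hM z) 2
  have havgM (K) : |avg K g| ≤ M := by
    rw [show avg K g = _ from (integral_expansion fun y => g (digitPoint y)).symm]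
    simpa using norm_integral_le_of_norm_le_const (μ := cubeMeasure d)
      (f := fun x => g (digitPoint (expansion b K x))) (ae_of_all _ fun x => hM _)
  have hlim : Tendsto (fun K => ∫ ω, (∑ i,
      (g (digitPoint (scrambledDigits K (fun v => π v ω) (x i))) - avg K g)) ^ 2 ∂P) atTop
      (𝓝 (∫ ω, (∑ i, (g (scramble (fun v => π v ω) (x i)) - ∫ z, g z ∂cubeMeasure d)) ^ 2 ∂P)) := by
    refine tendsto_integral_of_dominated_convergence (fun _ => (n * (M + M)) ^ 2)
      (fun K => ?_) (integrable_const _) (fun K => ae_of_all _ fun ω => ?_)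
      (ae_of_all _ fun ω => ?_)
    · exact ((Finset.measurable_sum _ fun i _ => (hg.measurable.comp (measurable_digitPoint.comp
        (measurable_scrambledDigits_comp hπ (x i)))).sub_const _).pow_const 2).aestronglyMeasurable
    · rw [norm_pow]
      refine pow_le_pow_left₀ (norm_nonneg _) ((norm_sum_le_of_le _ fun i _ =>
        (norm_sub_le _ _).trans (add_le_add (hM _) (havgM K))).trans_eq (by simp [mul_add])) 2
    · exact (tendsto_finsetSum _ fun i _ => ((hg.tendsto _).comp
        (tendsto_digitPoint_scrambledDigits hb _ (x i))).sub havg).pow 2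
  refine le_of_tendsto_of_tendsto' hlim (havg2.const_mul _) fun K => ?_
  have hsum0 : ∑ y : Fin d → Fin K → Fin b, (g (digitPoint y) - avg K g) = 0 := by
    rw [Finset.sum_sub_distrib, Finset.sum_const, Finset.card_univ, nsmul_eq_mul,
      mul_inv_cancel_left₀ (hcard K), sub_self]
  refine (integral_sq_sum_scrambledDigits_le hb hπ hx hΓ hsum0).trans ?_
  refine mul_le_mul_of_nonneg_left ?_ (by positivity)
  refine mul_le_mul_of_nonneg_left ?_ (by positivity)
  have h1 : ∑ y : Fin d → Fin K → Fin b, (g (digitPoint y) - avg K g) ^ 2 =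
      ∑ y : Fin d → Fin K → Fin b, (g (digitPoint y) ^ 2) -
        avg K g * (∑ y : Fin d → Fin K → Fin b, (g (digitPoint y) - avg K g)) -
        avg K g * ∑ y : Fin d → Fin K → Fin b, g (digitPoint y) := by
    rw [Finset.mul_sum, Finset.mul_sum, ← Finset.sum_sub_distrib, ← Finset.sum_sub_distrib]
    exact Finset.sum_congr rfl fun y _ => by ring
  have h2 : ∑ y : Fin d → Fin K → Fin b, g (digitPoint y) =
      (Fintype.card (Fin d → Fin K → Fin b) : ℝ) * avg K g :=
    (mul_inv_cancel_left₀ (hcard K) _).symm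
  rw [h1, hsum0, h2]
  have : 0 ≤ avg K g * ((Fintype.card (Fin d → Fin K → Fin b) : ℝ) * avg K g) := by
    rw [mul_left_comm]
    exact mul_nonneg (Nat.cast_nonneg _) (mul_self_nonneg _)
  linarith

end ScrambledNet

/-! ### Extension to square integrable functions -/

namespace ScrambledNet

section L2

variable {α : Type*} [MeasurableSpace α] {ν : Measure α}

lemma eLpNorm_two_sq {h : α → ℝ} (hh : MemLp h 2 ν) :
    eLpNorm h 2 ν ^ 2 = ENNReal.ofReal (∫ x, h x ^ 2 ∂ν) := by
  rw [hh.eLpNorm_eq_integral_rpow_norm two_ne_zero ENNReal.ofNat_ne_top,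
    ← ENNReal.ofReal_pow (by positivity)]
  congr 1
  simp only [ENNReal.toReal_ofNat, Real.rpow_ofNat, Real.norm_eq_abs, sq_abs]
  rw [← Real.rpow_natCast, ← Real.rpow_mul (integral_nonneg fun x => sq_nonneg _)]
  norm_num

lemma enorm_integral_le_eLpNorm_two [IsProbabilityMeasure ν] {h : α → ℝ}
    (hh : AEStronglyMeasurable h ν) : ‖∫ x, h x ∂ν‖ₑ ≤ eLpNorm h 2 ν := by
  refine (enorm_integral_le_lintegral_enorm h).trans ?_
  rw [← eLpNorm_one_eq_lintegral_enorm]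
  exact eLpNorm_le_eLpNorm_of_exponent_le one_le_two hh

end L2

variable {Ω : Type*} [MeasurableSpace Ω] {P : Measure Ω} [IsProbabilityMeasure P] {b d n : ℕ}
  [NeZero b] {π : Fin d × List (Fin b) → Ω → Equiv.Perm (Fin b)}

/-- The difference between the value of `h` at the scrambled point and the integral of `h`. -/
noncomputable def deviation (π : Fin d × List (Fin b) → Ω → Equiv.Perm (Fin b))
    (h : (Fin d → ℝ) → ℝ) (a : Fin d → ℝ) (ω : Ω) : ℝ :=
  h (scramble (fun v => π v ω) a) - ∫ z, h z ∂cubeMeasure d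

lemma memLp_deviation (hb : 2 ≤ b) (hπ : IsUniformPermutations P b d π)
    {h : (Fin d → ℝ) → ℝ} (hh : MemLp h 2 (cubeMeasure d)) (a : Fin d → ℝ) :
    MemLp (deviation π h a) 2 P :=
  (hh.comp_measurePreserving (measurePreserving_scramble hb hπ a)).sub (memLp_const _)

lemma eLpNorm_deviation_le (hb : 2 ≤ b) (hπ : IsUniformPermutations P b d π)
    {h : (Fin d → ℝ) → ℝ} (hh : MemLp h 2 (cubeMeasure d)) (a : Fin d → ℝ) :
    eLpNorm (deviation π h a) 2 P ≤ 2 * eLpNorm h 2 (cubeMeasure d) := by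
  have hmp := measurePreserving_scramble hb hπ a
  refine (eLpNorm_sub_le (hh.comp_measurePreserving hmp).aestronglyMeasurable
    aestronglyMeasurable_const one_le_two).trans ?_
  rw [eLpNorm_comp_measurePreserving hh.aestronglyMeasurable hmp,
    eLpNorm_const _ two_ne_zero (IsProbabilityMeasure.ne_zero P), two_mul]
  gcongr
  simpa using enorm_integral_le_eLpNorm_two hh.aestronglyMeasurable

/-- A crude bound of order `n` instead of `√n`. It serves for approximation errors, which can be
made small for fixed `n`, and for blocks too short to have a gain bound. -/
lemma eLpNorm_sum_deviation_le_card (hb : 2 ≤ b) (hπ : IsUniformPermutations P b d π)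
    {h : (Fin d → ℝ) → ℝ} (hh : MemLp h 2 (cubeMeasure d)) (x : Fin n → Fin d → ℝ) :
    eLpNorm (∑ i, deviation π h (x i)) 2 P ≤ n * (2 * eLpNorm h 2 (cubeMeasure d)) := by
  refine (eLpNorm_sum_le (fun i _ => (memLp_deviation hb hπ hh _).aestronglyMeasurable)
    one_le_two).trans ((Finset.sum_le_sum fun i _ => eLpNorm_deviation_le hb hπ hh (x i)).trans_eq ?_)
  simp

/-- The variance bound for square integrable functions. -/
lemma eLpNorm_sum_deviation_sq_le (hb : 2 ≤ b) (hπ : IsUniformPermutations P b d π)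
    {x : Fin n → Fin d → ℝ} (hx : ∀ i j, x i j ∈ Set.Ico (0 : ℝ) 1) {Γ : ℝ} (hΓ0 : 0 ≤ Γ)
    (hΓ : ∀ u : Finset (Fin d), u.Nonempty → ∀ k, gainCoefficient b x u k ≤ Γ)
    {f : (Fin d → ℝ) → ℝ} (hf : MemLp f 2 (cubeMeasure d)) :
    eLpNorm (∑ i, deviation π f (x i)) 2 P ≤
      ENNReal.ofReal √(n * Γ) * eLpNorm f 2 (cubeMeasure d) := by
  have hnΓ : 0 ≤ n * Γ := by positivity
  have hcont {g : (Fin d → ℝ) → ℝ} (hg : Continuous g) {M : ℝ} (hM : ∀ x, |g x| ≤ M)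
      (hg2 : MemLp g 2 (cubeMeasure d)) : eLpNorm (∑ i, deviation π g (x i)) 2 P ≤
      ENNReal.ofReal √(n * Γ) * eLpNorm g 2 (cubeMeasure d) := by
    rw [← ENNReal.pow_le_pow_left_iff two_ne_zero, mul_pow, eLpNorm_two_sq hg2,
      eLpNorm_two_sq (memLp_finsetSum' _ fun i _ => memLp_deviation hb hπ hg2 (x i)),
      ← ENNReal.ofReal_pow (Real.sqrt_nonneg _), Real.sq_sqrt hnΓ,
      ← ENNReal.ofReal_mul hnΓ]
    refine ENNReal.ofReal_le_ofReal ?_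
    simpa only [Finset.sum_apply, deviation] using
      integral_sq_sum_scramble_le_of_continuous hb hπ hx hΓ0 hΓ hg hM
  refine ENNReal.le_of_forall_pos_le_add fun ε hε _ => ?_
  -- Replacing `f` by `g` costs `√(n Γ) δ` through the norm of `g` and `2 n δ` through the
  -- deviations of `f - g`. For `n = 0` the witness is `∞`, which the zero factors absorb.
  obtain ⟨δ, hδ, hδε⟩ : ∃ δ : ℝ≥0∞, δ ≠ 0 ∧
      ENNReal.ofReal √(n * Γ) * δ + n * (2 * δ) ≤ ε := by
    have hC : ENNReal.ofReal √(n * Γ) + n * 2 ≠ ∞ := by finiteness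
    refine ⟨ε / (ENNReal.ofReal √(n * Γ) + n * 2), ?_, ?_⟩
    · exact (ENNReal.div_pos (by exact_mod_cast hε.ne') hC).ne'
    · rw [← mul_assoc, ← add_mul]
      exact ENNReal.mul_div_le
  obtain ⟨g, M, hgc, hM, hg, hg2⟩ : ∃ (g : (Fin d → ℝ) → ℝ) (M : ℝ), Continuous g ∧
      (∀ x, |g x| ≤ M) ∧ eLpNorm (f - g) 2 (cubeMeasure d) ≤ δ ∧ MemLp g 2 (cubeMeasure d) := by
    obtain ⟨g, hg, hg2⟩ := hf.exists_boundedContinuous_eLpNorm_sub_le ENNReal.ofNat_ne_top hδ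
    exact ⟨g, ‖g‖, g.continuous, g.norm_coe_le_norm, hg, hg2⟩
  have hfg : MemLp (f - g) 2 (cubeMeasure d) := hf.sub hg2
  have hdecomp : ∑ i, deviation π f (x i) =
      ∑ i, deviation π g (x i) + ∑ i, deviation π (f - g) (x i) := by
    rw [← Finset.sum_add_distrib]
    refine Finset.sum_congr rfl fun i _ => funext fun ω => ?_
    have : ∫ z, (f - g) z ∂cubeMeasure d =
        ∫ z, f z ∂cubeMeasure d - ∫ z, g z ∂cubeMeasure d :=
      integral_sub (hf.integrable one_le_two) (hg2.integrable one_le_two)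
    rw [Pi.add_apply, deviation, deviation, deviation, this, Pi.sub_apply]
    ring
  have hgf : eLpNorm g 2 (cubeMeasure d) ≤ eLpNorm f 2 (cubeMeasure d) + δ := by
    have : (g : (Fin d → ℝ) → ℝ) = f - (f - g) := by simp
    rw [this]
    exact (eLpNorm_sub_le hf.aestronglyMeasurable hfg.aestronglyMeasurable one_le_two).trans
      (by gcongr)
  rw [hdecomp]
  calc _ ≤ eLpNorm (∑ i, deviation π g (x i)) 2 P +
        eLpNorm (∑ i, deviation π (f - g) (x i)) 2 P :=
        eLpNorm_add_le
          (memLp_finsetSum' _ fun i _ => memLp_deviation hb hπ hg2 (x i)).aestronglyMeasurable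
          (memLp_finsetSum' _ fun i _ => memLp_deviation hb hπ hfg (x i)).aestronglyMeasurable
          one_le_two
    _ ≤ ENNReal.ofReal √(n * Γ) * (eLpNorm f 2 (cubeMeasure d) + δ) + n * (2 * δ) := by
        gcongr
        · exact (hcont hgc hM hg2).trans (by gcongr)
        · exact (eLpNorm_sum_deviation_le_card hb hπ hfg x).trans (by gcongr)
    _ = ENNReal.ofReal √(n * Γ) * eLpNorm f 2 (cubeMeasure d) +
        (ENNReal.ofReal √(n * Γ) * δ + n * (2 * δ)) := by ring
    _ ≤ _ := by gcongr

/-- The second moments of the sums over the blocks of `b ^ m` points are `O(b ^ m)`. -/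
lemma exists_integral_sq_sum_block_le (hb : 2 ≤ b) (hπ : IsUniformPermutations P b d π)
    {t : ℕ} {a : ℕ → Fin d → ℝ} (ha : IsSequence b t d a) {Γ : ℝ}
    (hΓ : GainCoefficientsLE b t d a Γ) {f : (Fin d → ℝ) → ℝ} (hf : MemLp f 2 (cubeMeasure d)) :
    ∃ C : ℝ, ∀ m r, ∫ ω, (∑ i ∈ Finset.range (b ^ m), deviation π f (a (r * b ^ m + i)) ω) ^ 2 ∂P ≤
      C * (b : ℝ) ^ m := by
  have hF : 0 ≤ ∫ z, f z ^ 2 ∂cubeMeasure d := integral_nonneg fun _ => sq_nonneg _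
  have hb1 : (1 : ℝ) ≤ b := by exact_mod_cast (by lia : 1 ≤ b)
  have hmem (m r) : MemLp (∑ i, deviation π f (block b m r a i)) 2 P :=
    memLp_finsetSum' _ fun i _ => memLp_deviation hb hπ hf _
  -- The first term serves `t ≤ m`. For `m ≤ t` the crude bound gives `4 b ^ (2 m) ∫ f²`, and `b ^ m
  -- ≤ b ^ t`.
  refine ⟨(max Γ 0 + 4 * (b : ℝ) ^ t) * ∫ z, f z ^ 2 ∂cubeMeasure d, fun m r => ?_⟩
  have hsum (ω : Ω) : ∑ i ∈ Finset.range (b ^ m), deviation π f (a (r * b ^ m + i)) ω =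
      (∑ i, deviation π f (block b m r a i)) ω := by
    rw [Finset.sum_range, Finset.sum_apply]
    rfl
  simp_rw [hsum]
  rcases le_total t m with htm | hmt
  · have h := eLpNorm_sum_deviation_sq_le hb hπ (ha.2 m htm r).1 (le_max_right Γ 0)
      (fun u hu k => (hΓ m htm r u hu k).trans (le_max_left _ _)) hf
    rw [← ENNReal.pow_le_pow_left_iff two_ne_zero, mul_pow, eLpNorm_two_sq hf,
      eLpNorm_two_sq (hmem m r), ← ENNReal.ofReal_pow (Real.sqrt_nonneg _),
      Real.sq_sqrt (by positivity), ← ENNReal.ofReal_mul (by positivity),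
      ENNReal.ofReal_le_ofReal_iff (by positivity)] at h
    refine h.trans ?_
    push_cast
    have : 0 ≤ 4 * (b : ℝ) ^ t * (∫ z, f z ^ 2 ∂cubeMeasure d) * (b : ℝ) ^ m := by positivity
    linarith
  · have h := eLpNorm_sum_deviation_le_card hb hπ hf (block b m r a)
    rw [← ENNReal.pow_le_pow_left_iff two_ne_zero, mul_pow, mul_pow, eLpNorm_two_sq hf,
      eLpNorm_two_sq (hmem m r), ← ENNReal.ofReal_natCast, ← ENNReal.ofReal_pow (by positivity),
      ← ENNReal.ofReal_ofNat 2, ← ENNReal.ofReal_pow (by positivity),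
      ← ENNReal.ofReal_mul (by positivity), ← ENNReal.ofReal_mul (by positivity),
      ENNReal.ofReal_le_ofReal_iff (by positivity)] at h
    refine h.trans ?_
    push_cast
    have h1 : (b : ℝ) ^ m ≤ (b : ℝ) ^ t := pow_le_pow_right₀ hb1 hmt
    have h2 : (b : ℝ) ^ m * ((b : ℝ) ^ m * ∫ z, f z ^ 2 ∂cubeMeasure d) ≤
        (b : ℝ) ^ t * ((b : ℝ) ^ m * ∫ z, f z ^ 2 ∂cubeMeasure d) :=
      mul_le_mul_of_nonneg_right h1 (by positivity)
    have h3 : 0 ≤ max Γ 0 * (∫ z, f z ^ 2 ∂cubeMeasure d) * (b : ℝ) ^ m := by positivity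
    nlinarith

end ScrambledNet

/-! ### Chaining over scales and almost sure convergence -/

namespace ScrambledNet

section Blocks

variable {b : ℕ}

/-- The sum over the `r`-th block of `b ^ m` consecutive terms. -/
def blockSum (b : ℕ) (y : ℕ → ℝ) (m r : ℕ) : ℝ :=
  ∑ i ∈ Finset.range (b ^ m), y (r * b ^ m + i)

lemma sum_range_mul_pow_eq_sum_blockSum (y : ℕ → ℝ) (m q : ℕ) :
    ∑ i ∈ Finset.range (q * b ^ m), y i = ∑ r ∈ Finset.range q, blockSum b y m r := by
  induction q with
  | zero => simp
  | succ q ih =>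
    rw [Nat.add_mul, one_mul, Finset.sum_range_add, ih, Finset.sum_range_succ, blockSum]

/-- The sum of squares of the block sums over the first `b ^ K` terms, on all scales. -/
def blockSquares (b : ℕ) (y : ℕ → ℝ) (K : ℕ) : ℝ :=
  ∑ m ∈ Finset.range K, ∑ r ∈ Finset.range (b ^ (K - m)), blockSum b y m r ^ 2

/-- The sum telescopes over truncations of `n` to multiples of `b ^ m`. Consecutive truncations
differ by as many blocks as the digit of `n` at place `m`, fewer than `b`. Cauchy–Schwarz costs `b`
within a scale and `K` across scales. -/
lemma sq_sum_range_le_blockSquares (hb : 0 < b) (y : ℕ → ℝ) {K n : ℕ} (hn : n < b ^ K) :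
    (∑ i ∈ Finset.range n, y i) ^ 2 ≤ K * b * blockSquares b y K := by
  let T (m : ℕ) : ℝ := ∑ r ∈ Finset.range (n / b ^ m), blockSum b y m r
  have hT0 : T 0 = ∑ i ∈ Finset.range n, y i := by
    simp only [T]
    rw [← sum_range_mul_pow_eq_sum_blockSum]
    simp
  have hTK : T K = 0 := by simp [T, Nat.div_eq_of_lt hn]
  have hstep (m : ℕ) : T m - T (m + 1) =
      ∑ r ∈ Finset.Ico (n / b ^ (m + 1) * b) (n / b ^ m), blockSum b y m r := by
    have hle : n / b ^ (m + 1) * b ≤ n / b ^ m := by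
      rw [pow_succ, ← Nat.div_div_eq_div_mul]
      exact Nat.div_mul_le_self _ _
    rw [Finset.sum_Ico_eq_sub _ hle]
    congr 1
    simp only [T]
    rw [← sum_range_mul_pow_eq_sum_blockSum, ← sum_range_mul_pow_eq_sum_blockSum]
    congr 2
    ring
  have hsq (m : ℕ) (hm : m < K) : (T m - T (m + 1)) ^ 2 ≤
      b * ∑ r ∈ Finset.range (b ^ (K - m)), blockSum b y m r ^ 2 := by
    rw [hstep]
    refine sq_sum_le_card_mul_sum_sq.trans ?_
    have hcard : (Finset.Ico (n / b ^ (m + 1) * b) (n / b ^ m)).card ≤ b := by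
      rw [Nat.card_Ico, pow_succ, ← Nat.div_div_eq_div_mul]
      have := Nat.div_add_mod' (n / b ^ m) b
      have := Nat.mod_lt (n / b ^ m) hb
      lia
    refine mul_le_mul (by exact_mod_cast hcard) ?_ (Finset.sum_nonneg fun _ _ => sq_nonneg _)
      (Nat.cast_nonneg b)
    refine Finset.sum_le_sum_of_subset_of_nonneg (fun r hr => ?_) fun _ _ _ => sq_nonneg _
    rw [Finset.mem_range]
    refine (Finset.mem_Ico.1 hr).2.trans_le (Nat.div_le_of_le_mul ?_)
    rw [← pow_add, Nat.add_sub_cancel' hm.le]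
    exact hn.le
  have htele : ∑ i ∈ Finset.range n, y i = ∑ m ∈ Finset.range K, (T m - T (m + 1)) := by
    rw [Finset.sum_range_sub', hT0, hTK, sub_zero]
  rw [htele]
  refine sq_sum_le_card_mul_sum_sq.trans ?_
  rw [Finset.card_range, mul_assoc, blockSquares, Finset.mul_sum (a := (b : ℝ))]
  exact mul_le_mul_of_nonneg_left
    (Finset.sum_le_sum fun m hm => hsq m (Finset.mem_range.1 hm)) (Nat.cast_nonneg K)

lemma tendsto_average_of_tendsto_blockSquares (hb : 2 ≤ b) (y : ℕ → ℝ)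
    (h : Tendsto (fun K : ℕ => K * blockSquares b y K / ((b : ℝ) ^ K) ^ 2) atTop (𝓝 0)) :
    Tendsto (fun n : ℕ => (1 / (n : ℝ)) * ∑ i ∈ Finset.range n, y i) atTop (𝓝 0) := by
  have hb0 : (0 : ℝ) < b := by positivity
  have hlog : Tendsto (fun n : ℕ => Nat.log b n + 1) atTop atTop := by
    refine (tendsto_add_atTop_nat 1).comp (tendsto_atTop.2 fun k => ?_)
    filter_upwards [eventually_ge_atTop (b ^ k)] with n hn
    exact Nat.le_log_of_pow_le (by lia) hn
  have hsq : Tendsto (fun n : ℕ => ((1 / (n : ℝ)) * ∑ i ∈ Finset.range n, y i) ^ 2)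
      atTop (𝓝 0) := by
    -- With `K = Nat.log b n + 1` one has `b ^ K ≤ b n`, so replacing `n ^ 2` by `b ^ (2 K)` costs
    -- `b ^ 2`; the third factor `b` comes from `sq_sum_range_le_blockSquares`.
    refine squeeze_zero' (Eventually.of_forall fun _ => sq_nonneg _) ?_
      (by simpa using (h.comp hlog).const_mul ((b : ℝ) ^ 3))
    filter_upwards [eventually_ge_atTop 1] with n hn
    have hlt : n < b ^ (Nat.log b n + 1) := Nat.lt_pow_succ_log_self (by lia) n
    have hle : (b : ℝ) ^ (Nat.log b n + 1) ≤ b * n := by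
      rw [pow_succ']
      exact mul_le_mul_of_nonneg_left (by exact_mod_cast Nat.pow_log_le_self b (by lia)) hb0.le
    have hn0 : (0 : ℝ) < n := by exact_mod_cast hn
    have h1 := sq_sum_range_le_blockSquares (by lia) y hlt
    have hQ : 0 ≤ ((Nat.log b n + 1 : ℕ) : ℝ) * b * blockSquares b y (Nat.log b n + 1) :=
      (sq_nonneg _).trans h1
    calc _ = (∑ i ∈ Finset.range n, y i) ^ 2 / (n : ℝ) ^ 2 := by ring
      _ ≤ (((Nat.log b n + 1 : ℕ) : ℝ) * b * blockSquares b y (Nat.log b n + 1)) /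
          (n : ℝ) ^ 2 := by gcongr
      _ ≤ (((Nat.log b n + 1 : ℕ) : ℝ) * b * blockSquares b y (Nat.log b n + 1)) /
          (((b : ℝ) ^ (Nat.log b n + 1)) / b) ^ 2 := by
          gcongr
          exact (div_le_iff₀' hb0).2 hle
      _ = _ := by
          push_cast
          field_simp
  refine tendsto_zero_iff_abs_tendsto_zero _ |>.2 ?_
  have := hsq.sqrt
  simpa only [Function.comp_def, Real.sqrt_sq_eq_abs, Real.sqrt_zero] using this

end Blocks

variable {Ω : Type*} [MeasurableSpace Ω] {P : Measure Ω}

/-- If the second moments of all block sums of a sequence of random variables are bounded by a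
multiple of the block length, the averages of the sequence converge to `0` almost surely. -/
lemma ae_tendsto_average_of_blockSum {b : ℕ} (hb : 2 ≤ b) {Y : ℕ → Ω → ℝ}
    (hY : ∀ i, MemLp (Y i) 2 P) {C : ℝ}
    (hC : ∀ m r, ∫ ω, blockSum b (fun i => Y i ω) m r ^ 2 ∂P ≤ C * (b : ℝ) ^ m) :
    ∀ᵐ ω ∂P, Tendsto (fun n : ℕ => (1 / (n : ℝ)) * ∑ i ∈ Finset.range n, Y i ω) atTop (𝓝 0) := by
  have hb0 : (0 : ℝ) < b := by positivity
  have hB (m r) : Integrable (fun ω => blockSum b (fun i => Y i ω) m r ^ 2) P :=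
    (memLp_finsetSum _ fun i _ => hY (r * b ^ m + i)).integrable_sq
  let W (K : ℕ) (ω : Ω) : ℝ :=
    K * blockSquares b (fun i => Y i ω) K / ((b : ℝ) ^ K) ^ 2
  have hW0 (K ω) : 0 ≤ W K ω := by
    refine div_nonneg (mul_nonneg (Nat.cast_nonneg K) ?_) (sq_nonneg _)
    exact Finset.sum_nonneg fun _ _ => Finset.sum_nonneg fun _ _ => sq_nonneg _
  have hWint (K) : Integrable (W K) P :=
    ((integrable_finsetSum _ fun m _ => integrable_finsetSum _ fun r _ => hB m r).const_mul
      _).div_const _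
  -- Each of the `K` scales has `b ^ (K - m)` blocks with second moment at most `C b ^ m`, hence
  -- contributes at most `C b ^ K`.
  have hWle (K) : ∫ ω, W K ω ∂P ≤ C * ((K : ℝ) ^ 2 * ((b : ℝ)⁻¹) ^ K) := by
    have hQ : ∫ ω, blockSquares b (fun i => Y i ω) K ∂P ≤ K * (C * (b : ℝ) ^ K) := by
      simp only [blockSquares]
      rw [integral_finsetSum _ fun m _ => integrable_finsetSum _ fun r _ => hB m r]
      refine (Finset.sum_le_sum fun m hm => ?_).trans_eq (b := ∑ m ∈ Finset.range K,
        C * (b : ℝ) ^ K) (by simp)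
      rw [integral_finsetSum _ fun r _ => hB m r]
      refine (Finset.sum_le_sum fun r _ => hC m r).trans_eq ?_
      rw [Finset.sum_const, Finset.card_range, nsmul_eq_mul, Nat.cast_pow, mul_left_comm,
        ← pow_add, Nat.sub_add_cancel (Finset.mem_range.1 hm).le]
    simp only [W]
    rw [integral_div, integral_const_mul]
    refine (div_le_div_of_nonneg_right (mul_le_mul_of_nonneg_left hQ (Nat.cast_nonneg K))
      (sq_nonneg _)).trans_eq ?_
    rw [inv_pow]
    field_simp
  have hsummable : Summable fun K : ℕ => C * ((K : ℝ) ^ 2 * ((b : ℝ)⁻¹) ^ K) :=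
    (summable_pow_mul_geometric_of_norm_lt_one 2 (by
      rw [norm_inv, Real.norm_natCast]
      exact inv_lt_one_of_one_lt₀ (by exact_mod_cast hb))).mul_left C
  -- Summable expectations make `∑ W K` almost surely finite, so its terms tend to zero.
  have hlint : ∫⁻ ω, ∑' K, ENNReal.ofReal (W K ω) ∂P ≠ ∞ := by
    rw [lintegral_tsum fun K => (hWint K).aemeasurable.ennreal_ofReal]
    refine ne_top_of_le_ne_top hsummable.tsum_ofReal_ne_top (ENNReal.tsum_le_tsum fun K => ?_)
    rw [← ofReal_integral_eq_lintegral_ofReal (hWint K) (ae_of_all _ (hW0 K))]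
    exact ENNReal.ofReal_le_ofReal (hWle K)
  have hmeas : AEMeasurable (fun ω => ∑' K, ENNReal.ofReal (W K ω)) P :=
    AEMeasurable.tsum fun K => (hWint K).aemeasurable.ennreal_ofReal
  filter_upwards [ae_lt_top' hmeas hlint] with ω hω
  refine tendsto_average_of_tendsto_blockSquares hb _ ?_
  have h := (ENNReal.tendsto_toReal_zero_iff fun K => ENNReal.ofReal_ne_top).2
    (ENNReal.tendsto_atTop_zero_of_tsum_ne_top hω.ne)
  simpa only [ENNReal.toReal_ofReal (hW0 _ _)] using h

end ScrambledNet

theorem theorem2 {Ω : Type*} [MeasurableSpace Ω] (P : Measure Ω) [IsProbabilityMeasure P]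
    (b t d : ℕ) [NeZero b] (hb : 2 ≤ b) (hd : 1 ≤ d)
    (a : ℕ → Fin d → ℝ) (ha : ScrambledNet.IsSequence b t d a)
    (Γ : ℝ) (hΓ : ScrambledNet.GainCoefficientsLE b t d a Γ)
    (π : Fin d × List (Fin b) → Ω → Equiv.Perm (Fin b))
    (hπ : ScrambledNet.IsUniformPermutations P b d π)
    (f : (Fin d → ℝ) → ℝ)
    (hf : MemLp f 2 (volume.restrict (Set.Icc (0 : Fin d → ℝ) 1)))
    (μ : ℝ) (hμ : ∫ x in Set.Icc (0 : Fin d → ℝ) 1, f x = μ) :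
    ∀ᵐ ω ∂P, Tendsto
      (fun n : ℕ => (1 / (n : ℝ)) *
        ∑ i ∈ Finset.range n, f (ScrambledNet.scramble (fun v => π v ω) (a i)))
      atTop (𝓝 μ) := by
  obtain ⟨C, hC⟩ := ScrambledNet.exists_integral_sq_sum_block_le hb hπ ha hΓ hf
  filter_upwards [ScrambledNet.ae_tendsto_average_of_blockSum hb
    (fun i => ScrambledNet.memLp_deviation hb hπ hf (a i)) hC] with ω hω
  refine (by simpa using hω.add_const μ : Tendsto _ atTop (𝓝 μ)).congr' ?_
  -- At `n = 0` the average is `0` by the convention for division, so the centred and uncentred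
  -- averages are compared only for `n ≥ 1`.
  filter_upwards [eventually_ge_atTop 1] with n hn
  have hn0 : (n : ℝ) ≠ 0 := by positivity
  simp only [ScrambledNet.deviation, hμ, Finset.sum_sub_distrib, Finset.sum_const,
    Finset.card_range, nsmul_eq_mul]
  field_simp
  ring
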